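/- Graphs are finite and may have loops and multiple edges; a loop adds 2 to the degree $d_G(v)$ of its vertex. A factor of $G$ is a spanning subgraph; it is an $L$-factor if its degree at each vertex $v$ lies in $L(v)$. A graph is $m$-tree-connected if it contains $m$ edge-disjoint spanning trees, and $k$-edge-connected if at least $k$ edges leave every nonempty proper subset of its vertices. Let $m\ge 0$ be an integer and let $G$ be a $2m$-edge-connected graph, with at least two vertices if $m>0$. Let $M$ and $M_0$ be two edge-disjoint loopless factors of $G$ with $\Delta(M)\le m$ and $|E(M_0)|\le m$, and let $M_0$ be directed, with out-degrees $d^+_{M_0}(v)$. For each vertex $v$, let $L(v)\subseteq\{m,\ldots,d_G(v)-d_{M_0}(v)\}$ and let $r(v)$ be a nonnegative integer, such that $\sum_{v\in V(G)}r(v)=m-|E(M_0)|$. If for each vertex $v$ $$|L(v)|\ge \left\lceil\frac{d_G(v)}{2}\right\rceil+1-r(v)-d^+_{M_0}(v),$$ then $G$ has an $m$-tree-connected $L$-factor $H$ with $E(M)\subseteq E(H)$ and $E(H)\cap E(M_0)=\emptyset$. Furthermore, for an arbitrary given vertex $z$, the lower bound required at $z$ can be reduced to $\lfloor d_G(z)/2\rfloor+1-r(z)-d^+_{M_0}(z)$.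 -/

import Mathlib

/-! Finite multigraphs with loops are terms of Mathlib's `Graph α β`; a factor of `G` is a spanning
subgraph `H ≤s G`. -/

namespace Graph

variable {α β : Type*}

/-- The degree `d_G(v)`: the number of edges incident with `v`, loops counted twice. -/
noncomputable def degree (G : Graph α β) (v : α) : ℕ :=
  {e | G.IsNonloopAt e v}.ncard + 2 * {e | G.IsLoopAt e v}.ncard

/-- The cut of `A`: the edges of `G` with exactly one end in `A`. -/
def cut (G : Graph α β) (A : Set α) : Set β :=
  {e | ∃ x y, G.IsLink e x y ∧ x ∈ A ∧ y ∉ A}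

/-- `G` is `k`-edge-connected: every nonempty proper vertex subset is left by at least `k` edges. -/
def IsEdgeConnected (G : Graph α β) (k : ℕ) : Prop :=
  ∀ A : Set α, A.Nonempty → A ⊂ G.vertexSet → k ≤ (G.cut A).ncard

/-- Two vertices are reachable from each other if they are joined by a (possibly trivial) walk. -/
def Reachable (G : Graph α β) (x y : α) : Prop := Relation.ReflTransGen G.Adj x y

/-- A graph is connected if it has a vertex and any two of its vertices are joined by a walk. -/
def IsConnected (G : Graph α β) : Prop :=
  G.vertexSet.Nonempty ∧ ∀ x ∈ G.vertexSet, ∀ y ∈ G.vertexSet, G.Reachable x y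

/-- A graph is acyclic if no edge `e` lies on a cycle, that is, if the ends of `e` are not joined
by a walk that avoids `e`. In particular there are no loops and no parallel edges. -/
def IsAcyclic (G : Graph α β) : Prop :=
  ∀ e x y, G.IsLink e x y → ¬ (G.deleteEdges {e}).Reachable x y

/-- A tree is a connected acyclic graph. -/
def IsTree (G : Graph α β) : Prop := G.IsConnected ∧ G.IsAcyclic

/-- `G` is `m`-tree-connected: it contains `m` pairwise edge-disjoint spanning trees. -/
def IsTreeConnected (G : Graph α β) (m : ℕ) : Prop :=
  ∃ T : Fin m → Graph α β, (∀ i, T i ≤s G ∧ (T i).IsTree) ∧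
    ∀ i j, i ≠ j → Disjoint (T i).edgeSet (T j).edgeSet

/-- An orientation of `G`: each edge gets a tail and a head, which are its two ends. -/
structure Orientation (G : Graph α β) where
  /-- The vertex that the edge leaves. -/
  tail : G.edgeSet → α
  /-- The vertex that the edge enters. -/
  head : G.edgeSet → α
  isLink : ∀ e : G.edgeSet, G.IsLink e (tail e) (head e)

/-- The out-degree `d⁺(v)`: the number of edges directed away from `v`. -/
noncomputable def Orientation.outDegree {G : Graph α β} (D : G.Orientation) (v : α) : ℕ :=
  {e | D.tail e = v}.ncard

/-- `H` is an `L`-factor of `G`: a spanning subgraph with `d_H(v) ∈ L(v)` for each vertex `v`. -/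
def IsListFactor (H G : Graph α β) (L : α → Finset ℕ) : Prop :=
  H ≤s G ∧ ∀ v ∈ G.vertexSet, H.degree v ∈ L v

end Graph

/-!
The edges of the factor are found in two steps: `m` disjoint spanning trees that cover `M`, together
with some reserved edges, and then a subset of the edges outside the trees that corrects the degrees.

**Degrees.** Suppose that the edges outside `M₀` contain `m` disjoint spanning trees covering `M`,
with union `U`, and that each vertex `v` owns `k v` edges at `v` outside `U`, no edge having two
owners. A degree list of `v` with lower end `m` loses at most `d_U(v) - m` values when the edges of
`U` are put into the factor, so if `|L v| ≥ d_G(v) + 1 - d_{M₀}(v) - m - k v`, then at most `k v` of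
the possible degrees of `v` in the rest of the graph are forbidden. The argument of Frank, Lau and
Szabó (`exists_subset_endDegree_notMem`) then yields the remaining edges of the factor. The hypothesis
on `|L v|` allows `k v = ⌊d_G(v) / 2⌋ - m + r v`, with the ceiling at `z`.

**Trees and owned edges.** These form a family of disjoint independent sets in `m` copies of the
graphic matroid and `k v` rank-one matroids for each vertex `v`, whose non-loops are the edges at `v`
outside `M`. Since `M` has maximum degree at most `m`, it is a union of `m` forests
(`exists_forest_cover`). Augmenting along shortest exchange chains never uncovers an edge, so a family
with the largest possible union exists that still covers `M`; optimality is witnessed by a set `F`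
that is spanned in every matroid by the part of the family inside it, and outside of which every edge
is covered (`IndepCover.exists_disjoint_cover`). As `M` consists of loops of the rank-one matroids, it
is covered by the trees.

**Counting.** Let `t` be the number of components of `F`, and `X` the set of the vertices at which
`F` has only edges of `M`. All the independent sets are bases as soon as
`|E \ (M₀ ∪ F)| ≥ m (t - 1) + ∑ v ∈ X, k v`. To see this, split off the vertices of `X` from the
components: what is left of a component has a cut of at least `2m` edges, and the edges of `F ∩ M` are
accounted for by `Δ(M) ≤ m` (`sum_endDegree_add_le`). The edges of `M₀` cost at most `|E(M₀)|`, which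
is made up for by `∑ v, r v = m - |E(M₀)|`; the half-integral excess caused by the exceptional vertex
`z` disappears by integrality (`card_le_of_components`).
-/

/-! ### Independent covers in several linear matroids -/

namespace LinearIndepOn

variable {K W β : Type*} [Field K] [AddCommGroup W] [Module K W] {g : β → W}

open Submodule in
theorem mem_span_image_inter {s a b : Set β} (hs : LinearIndepOn K g s) (ha : a ⊆ s) (hb : b ⊆ s)
    {w : W} (hwa : w ∈ span K (g '' a)) (hwb : w ∈ span K (g '' b)) :
    w ∈ span K (g '' (a ∩ b)) := by
  rw [Finsupp.mem_span_image_iff_linearCombination] at *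
  obtain ⟨l, hl, rfl⟩ := hwa
  obtain ⟨l', hl', h⟩ := hwb
  have := linearIndepOn_iffₛ.1 hs l (Finsupp.supported_mono ha hl) l'
    (Finsupp.supported_mono hb hl') h.symm
  subst this
  refine ⟨l, ?_, rfl⟩
  rw [Finsupp.mem_supported] at *
  exact Set.subset_inter hl hl'

open Submodule in
theorem mem_span_image_inter_of_forall_sdiff {s t : Set β} (hs : LinearIndepOn K g s) {w : W}
    (hw : w ∈ span K (g '' s)) (h : ∀ y ∈ s, y ∉ t → w ∈ span K (g '' (s \ {y}))) :
    w ∈ span K (g '' (s ∩ t)) := by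
  rw [Finsupp.mem_span_image_iff_linearCombination] at *
  obtain ⟨l, hl, rfl⟩ := hw
  refine ⟨l, ?_, rfl⟩
  rw [Finsupp.mem_supported] at *
  refine fun y hy ↦ ⟨hl hy, ?_⟩
  by_contra hyt
  obtain ⟨l', hl', h'⟩ := (Finsupp.mem_span_image_iff_linearCombination _).1 (h y (hl hy) hyt)
  have := linearIndepOn_iffₛ.1 hs l hl l' (Finsupp.supported_mono Set.sdiff_subset hl') h'.symm
  subst this
  exact (hl' hy).2 rfl

end LinearIndepOn

namespace IndepCover

open Submodule

variable {K W β ι : Type*} [Field K] [AddCommGroup W] [Module K W]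

/-- The elements reachable from `D` by at most `n` exchange steps: an element `x` leads to every
`y ∈ S i` whose removal from `S i` takes `f i x` out of the span. -/
def layer (K : Type*) [Field K] [Module K W] (f : ι → β → W) (S : ι → Set β) (D : Set β) :
    ℕ → Set β
  | 0 => D
  | n + 1 => layer K f S D n ∪
      {y | ∃ i, y ∈ S i ∧ ∃ x ∈ layer K f S D n, f i x ∉ span K (f i '' (S i \ {y}))}

variable {f : ι → β → W} {D : Set β}

theorem layer_mono {S : ι → Set β} : Monotone (layer K f S D) :=
  monotone_nat_of_le_succ fun _ ↦ Set.subset_union_left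

/-- If an element reachable from `D` can be added to one of the independent sets, then exchanging
along a shortest chain gives independent sets that cover an additional element of `D`. -/
theorem exists_cover_insert {E : Set β} (hD : D ⊆ E) (n : ℕ) :
    ∀ S : ι → Set β, (∀ i, S i ⊆ E) → (∀ i, LinearIndepOn K (f i) (S i)) →
      (∃ x ∈ layer K f S D n, ∃ i, f i x ∉ span K (f i '' S i)) →
      ∃ S' : ι → Set β, (∀ i, S' i ⊆ E) ∧ (∀ i, LinearIndepOn K (f i) (S' i)) ∧
        ∃ e ∈ D, insert e (⋃ i, S i) ⊆ ⋃ i, S' i := by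
  classical
  induction n with
  | zero =>
    rintro S hSE hS ⟨x, hx, i, hi⟩
    refine ⟨Function.update S i (insert x (S i)), fun j ↦ ?_, fun j ↦ ?_, x, hx, ?_⟩
    · obtain rfl | hj := eq_or_ne j i
      · simpa [Set.insert_subset_iff] using ⟨hD hx, hSE j⟩
      · simpa [hj] using hSE j
    · obtain rfl | hj := eq_or_ne j i
      · simpa using (hS j).insert hi
      · simpa [hj] using hS j
    · refine Set.insert_subset (Set.mem_iUnion.2 ⟨i, by simp⟩) (Set.iUnion_mono fun j ↦ ?_)
      obtain rfl | hj := eq_or_ne j i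
      · simp
      · simp [hj]
  | succ n ih =>
    rintro S hSE hS ⟨x, hx, i, hi⟩
    by_cases hn : ∃ x ∈ layer K f S D n, ∃ i, f i x ∉ span K (f i '' S i)
    · exact ih S hSE hS hn
    push Not at hn
    have hxn : x ∉ layer K f S D n := fun h ↦ hi (hn x h i)
    obtain h | ⟨i', hxi', y, hy, hyx⟩ := hx
    · exact absurd h hxn
    have hxi : x ∉ S i := fun h ↦ hi (subset_span ⟨x, h, rfl⟩)
    have hii : i' ≠ i := by rintro rfl; exact hxi hxi'
    set S' : ι → Set β := Function.update (Function.update S i' (S i' \ {x})) i (insert x (S i))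
      with hS'
    have hSi : S' i = insert x (S i) := by simp [hS']
    have hSi' : S' i' = S i' \ {x} := by simp [hS', hii]
    have hSo : ∀ j, j ≠ i → j ≠ i' → S' j = S j := fun j h h' ↦ by simp [hS', h, h']
    have hind : ∀ j, LinearIndepOn K (f j) (S' j) := fun j ↦ by
      obtain rfl | hj := eq_or_ne j i
      · rw [hSi]; exact (hS j).insert hi
      obtain rfl | hj' := eq_or_ne j i'
      · rw [hSi']; exact (hS j).mono Set.sdiff_subset
      · rw [hSo j hj hj']; exact hS j
    have hSE' : ∀ j, S' j ⊆ E := fun j ↦ by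
      obtain rfl | hj := eq_or_ne j i
      · rw [hSi]; exact Set.insert_subset (hSE _ hxi') (hSE j)
      obtain rfl | hj' := eq_or_ne j i'
      · rw [hSi']; exact Set.sdiff_subset.trans (hSE j)
      · rw [hSo j hj hj']; exact hSE j
    -- the exchange does not disturb the earlier layers, because `x` occurs in none of them
    have hlayer : ∀ l ≤ n, layer K f S D l ⊆ layer K f S' D l := by
      intro l
      induction l with
      | zero => exact fun _ ↦ subset_rfl
      | succ l ihl =>
        intro hl
        refine Set.union_subset_union (ihl (by lia)) ?_
        rintro z ⟨k, hzk, w, hw, hwz⟩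
        have hz : z ∈ layer K f S D n := layer_mono hl (Or.inr ⟨k, hzk, w, hw, hwz⟩)
        have hw' : f k w ∈ span K (f k '' S k) := hn w (layer_mono (by lia) hw) k
        refine ⟨k, ?_, w, ihl (by lia) hw, ?_⟩
        · obtain rfl | hj := eq_or_ne k i
          · rw [hSi]; exact Or.inr hzk
          obtain rfl | hj' := eq_or_ne k i'
          · rw [hSi']; exact ⟨hzk, by rintro rfl; exact hxn hz⟩
          · rwa [hSo k hj hj']
        · contrapose! hwz
          obtain rfl | hj := eq_or_ne k i
          · have hsub : S k ⊆ S' k := by rw [hSi]; exact Set.subset_insert _ _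
            refine span_mono (Set.image_mono ?_)
              ((hind k).mem_span_image_inter hsub Set.sdiff_subset hw' hwz)
            exact fun u hu ↦ ⟨hu.1, hu.2.2⟩
          obtain rfl | hj' := eq_or_ne k i'
          · rw [hSi'] at hwz
            exact span_mono (Set.image_mono (Set.sdiff_subset_sdiff_left Set.sdiff_subset)) hwz
          · rwa [hSo k hj hj'] at hwz
    obtain ⟨S'', h1, h2, e, he, h3⟩ := ih S' hSE' hind ⟨y, hlayer n le_rfl hy, i', by rwa [hSi']⟩
    refine ⟨S'', h1, h2, e, he, (Set.insert_subset_insert ?_).trans h3⟩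
    refine Set.iUnion_subset fun j u hu ↦ Set.mem_iUnion.2 ?_
    obtain rfl | hux := eq_or_ne u x
    · exact ⟨i, by rw [hSi]; exact Or.inl rfl⟩
    refine ⟨j, ?_⟩
    obtain rfl | hj := eq_or_ne j i
    · rw [hSi]; exact Or.inr hu
    obtain rfl | hj' := eq_or_ne j i'
    · rw [hSi']; exact ⟨hu, hux⟩
    · rwa [hSo j hj hj']

/-- The min–max theorem for unions of linear matroids in the form of an optimality certificate: some
disjoint independent sets, which together cover what a given independent family covers, cover all
of `E` outside a set `F` that is spanned, in each of the matroids, by the part of the corresponding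
independent set inside `F`. -/
theorem exists_disjoint_cover {E : Set β} (hE : E.Finite) (S₀ : ι → Set β) (hS₀E : ∀ i, S₀ i ⊆ E)
    (hS₀ : ∀ i, LinearIndepOn K (f i) (S₀ i)) :
    ∃ (S : ι → Set β) (F : Set β), (∀ i, S i ⊆ E) ∧ (∀ i, LinearIndepOn K (f i) (S i)) ∧
      Pairwise (Function.onFun Disjoint S) ∧ ⋃ i, S₀ i ⊆ ⋃ i, S i ∧ F ⊆ E ∧
      E \ F ⊆ ⋃ i, S i ∧ ∀ i, ∀ x ∈ F, f i x ∈ span K (f i '' (S i ∩ F)) := by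
  classical
  let 𝒰 : Set (Set β) := {U | ⋃ i, S₀ i ⊆ U ∧ ∃ S : ι → Set β, (∀ i, S i ⊆ E) ∧
    (∀ i, LinearIndepOn K (f i) (S i)) ∧ ⋃ i, S i = U}
  have h𝒰 : 𝒰.Finite := hE.finite_subsets.subset <| by
    rintro _ ⟨-, S, hS, -, rfl⟩
    exact Set.iUnion_subset hS
  obtain ⟨U, hU⟩ := h𝒰.exists_maximal ⟨_, subset_rfl, S₀, hS₀E, hS₀, rfl⟩
  obtain ⟨hU₀, R, hRE, hR, hRU⟩ := hU.prop
  -- keep each covered element in only one of the sets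
  have hc : ∀ x ∈ U, ∃ i, x ∈ R i := fun x hx ↦ Set.mem_iUnion.1 (hRU ▸ hx)
  choose c hc using hc
  let S : ι → Set β := fun i ↦ {x | ∃ h : x ∈ U, c x h = i}
  have hSR : ∀ i, S i ⊆ R i := by
    rintro _ x ⟨h, rfl⟩
    exact hc x h
  have hSU : ⋃ i, S i = U := by
    refine Set.Subset.antisymm (Set.iUnion_subset fun i x hx ↦ hx.1) fun x hx ↦ ?_
    exact Set.mem_iUnion.2 ⟨c x hx, hx, rfl⟩
  have hSE : ∀ i, S i ⊆ E := fun i ↦ (hSR i).trans (hRE i)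
  have hS : ∀ i, LinearIndepOn K (f i) (S i) := fun i ↦ (hR i).mono (hSR i)
  set D := E \ U
  have hspan : ∀ n, ∀ x ∈ layer K f S D n, ∀ i, f i x ∈ span K (f i '' S i) := by
    by_contra! hcon
    obtain ⟨n, hn⟩ := hcon
    obtain ⟨S', h1, h2, e, he, h3⟩ := exists_cover_insert Set.sdiff_subset n S hSE hS hn
    rw [hSU, Set.insert_subset_iff] at h3
    exact he.2 (hU.le_of_ge ⟨hU₀.trans h3.2, S', h1, h2, rfl⟩ h3.2 h3.1)
  refine ⟨S, ⋃ n, layer K f S D n, hSE, hS, ?_, hSU.symm ▸ hU₀, ?_, ?_, ?_⟩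
  · rintro i j hij
    refine Set.disjoint_left.2 ?_
    rintro x ⟨h, rfl⟩ ⟨h', rfl⟩
    exact hij rfl
  · refine Set.iUnion_subset fun n ↦ ?_
    induction n with
    | zero => exact Set.sdiff_subset
    | succ n ih =>
      refine Set.union_subset ih ?_
      rintro z ⟨k, hz, -⟩
      exact hSE k hz
  · rintro x ⟨hxE, hxF⟩
    by_contra hx
    rw [hSU] at hx
    exact hxF (Set.mem_iUnion.2 ⟨0, hxE, hx⟩)
  · intro i x hx
    obtain ⟨n, hn⟩ := Set.mem_iUnion.1 hx
    refine (hS i).mem_span_image_inter_of_forall_sdiff (hspan n x hn i) fun y hy hyF ↦ ?_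
    by_contra hxy
    exact hyF (Set.mem_iUnion.2 ⟨n + 1, Or.inr ⟨i, hy, x, hn, hxy⟩⟩)

end IndepCover

/-! ### Degrees in edge sets with prescribed ends -/

open Classical in
/-- The degree of `v` in the edge set `A`, where `a e` and `b e` are the ends of the edge `e`;
a loop counts twice. -/
noncomputable def endDegree {α β : Type*} (a b : β → α) (A : Finset β) (v : α) : ℕ :=
  (A.filter fun e ↦ a e = v).card + (A.filter fun e ↦ b e = v).card

namespace endDegree

open Finset

variable {α β : Type*} {a b : β → α}

theorem mono {A B : Finset β} (h : A ⊆ B) (v : α) : endDegree a b A v ≤ endDegree a b B v := by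
  classical
  exact add_le_add (card_le_card (filter_subset_filter _ h))
    (card_le_card (filter_subset_filter _ h))

theorem union [DecidableEq β] {A B : Finset β} (h : Disjoint A B) (v : α) :
    endDegree a b (A ∪ B) v = endDegree a b A v + endDegree a b B v := by
  classical
  unfold endDegree
  rw [filter_union, filter_union, card_union_of_disjoint (disjoint_filter_filter h),
    card_union_of_disjoint (disjoint_filter_filter h)]
  ring

theorem sdiff_add [DecidableEq β] {A B : Finset β} (h : A ⊆ B) (v : α) :
    endDegree a b (B \ A) v + endDegree a b A v = endDegree a b B v := by
  rw [← union sdiff_disjoint, sdiff_union_of_subset h]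

theorem insert [DecidableEq β] {A : Finset β} {e : β} (h : e ∉ A) (v : α) :
    endDegree a b (insert e A) v = endDegree a b A v + endDegree a b {e} v := by
  rw [insert_eq, union (by simpa using h), add_comm]

theorem singleton_pos {e : β} {v : α} (h : a e = v ∨ b e = v) : 0 < endDegree a b {e} v := by
  classical
  unfold endDegree
  obtain h | h := h <;> simp [filter_singleton, h]

theorem eq_zero {A : Finset β} {v : α} (h : ∀ e ∈ A, a e ≠ v ∧ b e ≠ v) :
    endDegree a b A v = 0 := by
  classical
  unfold endDegree
  rw [filter_false_of_mem fun e he ↦ (h e he).1, filter_false_of_mem fun e he ↦ (h e he).2]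
  rfl

theorem sum_eq [DecidableEq α] (A : Finset β) (U : Finset α) :
    ∑ v ∈ U, endDegree a b A v = (A.filter fun e ↦ a e ∈ U).card +
      (A.filter fun e ↦ b e ∈ U).card := by
  classical
  unfold endDegree
  rw [sum_add_distrib]
  congr 1
  · rw [card_eq_sum_card_fiberwise (f := a) (t := U) (fun e he ↦ by simpa using (mem_filter.1 he).2)]
    refine sum_congr rfl fun v hv ↦ ?_
    rw [filter_filter]
    congr 1
    ext e
    simp only [mem_filter]
    constructor
    · rintro ⟨h, rfl⟩; exact ⟨h, hv, rfl⟩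
    · rintro ⟨h, -, h'⟩; exact ⟨h, h'⟩
  · rw [card_eq_sum_card_fiberwise (f := b) (t := U) (fun e he ↦ by simpa using (mem_filter.1 he).2)]
    refine sum_congr rfl fun v hv ↦ ?_
    rw [filter_filter]
    congr 1
    ext e
    simp only [mem_filter]
    constructor
    · rintro ⟨h, rfl⟩; exact ⟨h, hv, rfl⟩
    · rintro ⟨h, -, h'⟩; exact ⟨h, h'⟩

/-- The handshake identity. -/
theorem sum_eq_two_mul {A : Finset β} {V : Finset α} (h : ∀ e ∈ A, a e ∈ V ∧ b e ∈ V) :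
    ∑ v ∈ V, endDegree a b A v = 2 * A.card := by
  classical
  rw [sum_eq, filter_true_of_mem fun e he ↦ (h e he).1, filter_true_of_mem fun e he ↦ (h e he).2]
  ring

end endDegree

/-! ### Subgraphs with forbidden degrees -/

open Finset in
/-- If each vertex `v` owns at least as many of its edges as it has forbidden degrees, then some
subset of the edges avoids all forbidden degrees. An edge owned by a vertex `v` at which `0` is
forbidden may be put into the subset: this lowers the forbidden degrees at the ends of the edge, and
`v` loses one owned edge together with its forbidden degree `0`. -/
theorem exists_subset_endDegree_notMem {α β : Type*} (a b : β → α) (W : Finset β)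
    (Z : α → Finset β) (hZW : ∀ v, Z v ⊆ W) (hZ : Pairwise (Function.onFun Disjoint Z))
    (hZv : ∀ v, ∀ e ∈ Z v, a e = v ∨ b e = v) (F : α → Finset ℕ)
    (hF : ∀ v, (F v).card ≤ (Z v).card) :
    ∃ H ⊆ W, ∀ v, endDegree a b H v ∉ F v := by
  classical
  induction W using Finset.strongInduction generalizing Z F with
  | H W ih =>
    by_cases h0 : ∀ v, 0 ∉ F v
    · exact ⟨∅, empty_subset _, fun v ↦ by simpa [endDegree] using h0 v⟩
    push Not at h0
    obtain ⟨v, hv⟩ := h0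
    obtain ⟨e, he⟩ : (Z v).Nonempty := card_pos.1 ((card_pos.2 ⟨0, hv⟩).trans_le (hF v))
    have heW := hZW v he
    let F' : α → Finset ℕ := fun u ↦
      ((F u).filter (endDegree a b {e} u ≤ ·)).image (· - endDegree a b {e} u)
    have hF' : ∀ u, (F' u).card ≤ (F u).card := fun u ↦
      card_image_le.trans (card_filter_le _ _)
    obtain ⟨H, hHW, hH⟩ := ih (W.erase e) (erase_ssubset heW) (fun u ↦ (Z u).erase e)
      (fun u ↦ erase_subset_erase _ (hZW u))
      (fun u w huw ↦ (hZ huw).mono (erase_subset _ _) (erase_subset _ _))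
      (fun u x hx ↦ hZv u x (mem_of_mem_erase hx)) F' fun u ↦ by
        obtain rfl | huv := eq_or_ne u v
        · rw [card_erase_of_mem he]
          have hlt : (F' u).card < (F u).card := by
            refine card_image_le.trans_lt (card_lt_card ?_)
            refine filter_ssubset.2 ⟨0, hv, ?_⟩
            have := endDegree.singleton_pos (hZv u e he)
            lia
          have := hF u
          lia
        · have heu : e ∉ Z u := fun h ↦ (disjoint_left.1 (hZ huv) h) he
          rw [erase_eq_of_notMem heu]
          exact (hF' u).trans (hF u)
    have heH : e ∉ H := fun h ↦ (mem_erase.1 (hHW h)).1 rfl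
    refine ⟨insert e H, insert_subset heW (hHW.trans (erase_subset _ _)), fun u hu ↦ hH u ?_⟩
    rw [endDegree.insert heH] at hu
    exact mem_image.2 ⟨_, mem_filter.2 ⟨hu, Nat.le_add_left _ _⟩, Nat.add_sub_cancel _ _⟩

/-! ### Edge vectors and forests -/

/-- The column of the edge `e` in the incidence matrix of the graph with ends `a` and `b`, with
respect to the orientation of each edge `e` from `b e` to `a e`. -/
noncomputable def edgeVec {α β : Type*} (a b : β → α) (e : β) : α →₀ ℚ :=
  Finsupp.single (a e) 1 - Finsupp.single (b e) 1

section

open Submodule Finset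

theorem LinearIndepOn.card_le_card_of_subset_span {K W β : Type*} [Field K] [AddCommGroup W]
    [Module K W] {g : β → W} {T : Finset β} (hT : LinearIndepOn K g (T : Set β)) {U : Finset W}
    (h : g '' T ⊆ span K (U : Set W)) : T.card ≤ U.card := by
  have h1 := finrank_span_eq_card (R := K) hT
  rw [show Set.range (fun x : (T : Set β) ↦ g x) = g '' T by ext; simp] at h1
  have h2 := Submodule.finrank_mono (span_le.2 h)
  have h3 := finrank_span_finset_le_card (R := K) U
  simp only [Set.finrank] at h3
  simp only [Fintype.card_coe, coe_sort_coe] at h1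
  lia

variable {α β : Type*} {a b : β → α}

theorem edgeVec_mem_span_sub_single {V : Finset α} {e : β} (he : a e ∈ V ∧ b e ∈ V)
    {x₀ : α} [DecidableEq α] :
    edgeVec a b e ∈ span ℚ ((V.erase x₀).image
      fun v ↦ (Finsupp.single v 1 - Finsupp.single x₀ 1 : α →₀ ℚ) : Set (α →₀ ℚ)) := by
  have key : ∀ v ∈ V, (Finsupp.single v 1 - Finsupp.single x₀ 1 : α →₀ ℚ) ∈
      span ℚ ((V.erase x₀).image
      fun v ↦ (Finsupp.single v 1 - Finsupp.single x₀ 1 : α →₀ ℚ) : Set (α →₀ ℚ)) := by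
    intro v hv
    obtain rfl | hne := eq_or_ne v x₀
    · simp
    · exact subset_span (by
        rw [Finset.coe_image]
        exact ⟨v, by simp [hne, hv], rfl⟩)
  have := sub_mem (key _ he.1) (key _ he.2)
  rwa [sub_sub_sub_cancel_right] at this

/-- A forest on a nonempty vertex set `V` has fewer than `|V|` edges. -/
theorem card_forest_lt {V : Finset α} (hV : V.Nonempty) {T : Finset β}
    (hTV : ∀ e ∈ T, a e ∈ V ∧ b e ∈ V) (hT : LinearIndepOn ℚ (edgeVec a b) (T : Set β)) :
    T.card + 1 ≤ V.card := by
  classical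
  obtain ⟨x₀, hx₀⟩ := hV
  have := hT.card_le_card_of_subset_span (U := (V.erase x₀).image
      fun v ↦ (Finsupp.single v 1 - Finsupp.single x₀ 1 : α →₀ ℚ)) <| by
    rintro _ ⟨e, he, rfl⟩
    exact edgeVec_mem_span_sub_single (hTV e he)
  have h2 := this.trans card_image_le
  rw [card_erase_of_mem hx₀] at h2
  have := card_pos.2 ⟨x₀, hx₀⟩
  lia

/-- A forest on `V` with `|V| - 1` edges is spanning. -/
theorem sub_single_mem_span_of_card {V : Finset α} {T : Finset β}
    (hTV : ∀ e ∈ T, a e ∈ V ∧ b e ∈ V) (hT : LinearIndepOn ℚ (edgeVec a b) (T : Set β))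
    (hcard : V.card ≤ T.card + 1) {x y : α} (hx : x ∈ V) (hy : y ∈ V) :
    (Finsupp.single x 1 - Finsupp.single y 1 : α →₀ ℚ) ∈ span ℚ (edgeVec a b '' T) := by
  classical
  set U := (V.erase y).image fun v ↦ (Finsupp.single v 1 - Finsupp.single y 1 : α →₀ ℚ) with hU
  have hle : span ℚ (edgeVec a b '' T) ≤ span ℚ (U : Set (α →₀ ℚ)) := by
    rw [span_le]
    rintro _ ⟨e, he, rfl⟩
    exact edgeVec_mem_span_sub_single (hTV e he)
  have h1 := finrank_span_eq_card (R := ℚ) hT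
  rw [show Set.range (fun x : (T : Set β) ↦ edgeVec a b x) = edgeVec a b '' T by ext; simp] at h1
  simp only [Fintype.card_coe, coe_sort_coe] at h1
  have h3 := finrank_span_finset_le_card (R := ℚ) U
  simp only [Set.finrank] at h3
  have h4 : U.card ≤ V.card - 1 := card_image_le.trans (card_erase_of_mem hy).le
  rw [Submodule.eq_of_le_of_finrank_le hle (by lia)]
  obtain rfl | hne := eq_or_ne x y
  · simp
  · refine subset_span ?_
    rw [hU, Finset.coe_image]
    exact ⟨x, by simp [hne, hx], rfl⟩

/-- A set of edges spanning `F` has at least `|V| - t` edges, where `t` is the number of connected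
components of `F` on the vertex set `V`. -/
theorem card_le_card_add_card_image [DecidableEq α] {V : Finset α} {F : Set β} {κ : α → α}
    (hκ : ∀ v ∈ V, (Finsupp.single v 1 - Finsupp.single (κ v) 1 : α →₀ ℚ) ∈
      span ℚ (edgeVec a b '' F)) {T : Finset β}
    (hT : ∀ e ∈ F, edgeVec a b e ∈ span ℚ (edgeVec a b '' T)) :
    V.card ≤ T.card + (V.image κ).card := by
  classical
  have hle : span ℚ (edgeVec a b '' F) ≤ span ℚ (edgeVec a b '' T) := by
    rw [span_le]
    rintro _ ⟨e, he, rfl⟩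
    exact hT e he
  have hind : LinearIndepOn ℚ (fun v : α ↦ (Finsupp.single v 1 : α →₀ ℚ)) (V : Set α) :=
    (Finsupp.linearIndependent_single_one ℚ α).linearIndepOn _
  have := hind.card_le_card_of_subset_span
    (U := T.image (edgeVec a b) ∪ (V.image κ).image fun v ↦ (Finsupp.single v 1 : α →₀ ℚ)) <| by
    rintro _ ⟨v, hv, rfl⟩
    have h1 := hle (hκ v hv)
    have h2 : (Finsupp.single (κ v) 1 : α →₀ ℚ) ∈
        span ℚ ((V.image κ).image fun v ↦ (Finsupp.single v 1 : α →₀ ℚ) : Set (α →₀ ℚ)) := by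
      refine subset_span ?_
      rw [Finset.coe_image, Finset.coe_image]
      exact ⟨κ v, ⟨v, hv, rfl⟩, rfl⟩
    rw [coe_union, span_union, coe_image (f := edgeVec a b)]
    have h3 := Submodule.add_mem_sup h1 h2
    rwa [sub_add_cancel] at h3
  refine this.trans ((card_union_le _ _).trans ?_)
  exact add_le_add card_image_le card_image_le

/-- A choice of a representative in each connected component of an edge set `F`. -/
theorem exists_component_representative (a b : β → α) (F : Set β) :
    ∃ κ : α → α, (∀ e ∈ F, κ (a e) = κ (b e)) ∧
      ∀ v, (Finsupp.single v 1 - Finsupp.single (κ v) 1 : α →₀ ℚ) ∈ span ℚ (edgeVec a b '' F) := by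
  let s : Setoid α :=
    { r := fun v w ↦ (Finsupp.single v 1 - Finsupp.single w 1 : α →₀ ℚ) ∈
        span ℚ (edgeVec a b '' F)
      iseqv :=
        { refl := fun v ↦ by simp
          symm := fun {v w} h ↦ by simpa using neg_mem h
          trans := fun {u v w} h h' ↦ by simpa using add_mem h h' } }
  refine ⟨fun v ↦ (Quotient.mk s v).out, fun e he ↦ ?_, fun v ↦ s.symm (Quotient.mk_out v)⟩
  have : Quotient.mk s (a e) = Quotient.mk s (b e) := Quotient.sound (subset_span ⟨e, he, rfl⟩)
  simp only [this]

end

section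

open Submodule Finset

variable {α β : Type*} {a b : β → α}

/-! ### Counting edges between components -/

/-- If a component `C` is a single vertex, looplessness leaves no edges in it; otherwise
`m |C| + 2m ≤ 2m |C|`. -/
theorem sum_endDegree_component_le {m : ℕ} {V C : Finset α} {F : Finset β} {κ : α → α}
    [DecidableEq α] (hFV : ∀ e ∈ F, a e ∈ V ∧ b e ∈ V) (hκ : ∀ e ∈ F, κ (a e) = κ (b e))
    (hloop : ∀ e ∈ F, a e ≠ b e) (hdeg : ∀ v ∈ V, endDegree a b F v ≤ m) {c : α}
    (hc : c ∈ V.image κ) (hC : C = V.filter (κ · = c)) :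
    ∑ v ∈ C, endDegree a b F v + 2 * m ≤ 2 * m * C.card := by
  have hCV : C ⊆ V := hC ▸ filter_subset _ _
  obtain ⟨v, hv, hvc⟩ := mem_image.1 hc
  have hpos : 0 < C.card := card_pos.2 ⟨v, by simp [hC, hv, hvc]⟩
  obtain h1 | h2 : C.card = 1 ∨ 2 ≤ C.card := by lia
  · obtain ⟨w, rfl⟩ := card_eq_one.1 h1
    have h0 : endDegree a b F w = 0 := endDegree.eq_zero fun e he ↦ by
      have hw : ∀ u ∈ V, κ u = c → u = w := fun u hu huc ↦ by
        have : u ∈ V.filter (κ · = c) := by simp [hu, huc]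
        simpa [← hC] using this
      have hwc : κ w = c := by
        have : w ∈ V.filter (κ · = c) := by simp [← hC]
        exact (mem_filter.1 this).2
      constructor
      · rintro rfl
        exact hloop e he (hw _ (hFV e he).2 ((hκ e he).symm.trans hwc)).symm
      · rintro rfl
        exact hloop e he (hw _ (hFV e he).1 ((hκ e he).trans hwc))
    simp [h0]
  · have := sum_le_card_nsmul C _ m fun u hu ↦ hdeg u (hCV hu)
    rw [smul_eq_mul] at this
    nlinarith

/-- A loopless graph of maximum degree at most `m` decomposes into `m` forests. -/
theorem exists_forest_cover {m : ℕ} {V : Finset α} {M : Finset β}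
    (hMV : ∀ e ∈ M, a e ∈ V ∧ b e ∈ V) (hloop : ∀ e ∈ M, a e ≠ b e)
    (hdeg : ∀ v ∈ V, endDegree a b M v ≤ m) :
    ∃ S : Fin m → Set β, (∀ i, S i ⊆ M) ∧ (∀ i, LinearIndepOn ℚ (edgeVec a b) (S i)) ∧
      (M : Set β) ⊆ ⋃ i, S i := by
  classical
  obtain ⟨S, F, hSM, hS, hdis, -, hFM, hcov, hspan⟩ :=
    IndepCover.exists_disjoint_cover (K := ℚ) (ι := Fin m) (f := fun _ ↦ edgeVec a b)
      M.finite_toSet (fun _ ↦ ∅) (by simp) (by simp)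
  refine ⟨S, hSM, hS, ?_⟩
  by_contra hM
  obtain ⟨e, heM, heS⟩ := Set.not_subset.1 hM
  lift F to Finset β using M.finite_toSet.subset hFM
  have hFM' : F ⊆ M := by exact_mod_cast hFM
  have heF : e ∈ F := by
    by_contra h
    exact heS (hcov ⟨heM, h⟩)
  obtain ⟨κ, hκ, hκspan⟩ := exists_component_representative a b (F : Set β)
  let T : Fin m → Finset β := fun i ↦ F.filter (· ∈ S i)
  have hT : ∀ i, ((T i : Finset β) : Set β) = S i ∩ F := fun i ↦ by
    ext x; simp [T, and_comm]
  have hTcard : ∀ i, V.card ≤ (T i).card + (V.image κ).card := fun i ↦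
    card_le_card_add_card_image (a := a) (b := b) (F := F) (fun v _ ↦ hκspan v)
      fun x hx ↦ by rw [hT]; exact hspan i x hx
  have hcard : ∑ i, (T i).card + 1 ≤ F.card := by
    have hTdis : Set.PairwiseDisjoint (univ : Finset (Fin m)) T := fun i _ j _ hij ↦
      disjoint_left.2 fun x hx hx' ↦
        Set.disjoint_left.1 (hdis hij) (mem_filter.1 hx).2 (mem_filter.1 hx').2
    rw [← card_biUnion hTdis]
    refine card_lt_card ⟨biUnion_subset.2 fun i _ ↦ filter_subset _ _, fun h ↦ heS ?_⟩
    obtain ⟨i, -, hi⟩ := mem_biUnion.1 (h heF)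
    exact Set.mem_iUnion.2 ⟨i, (mem_filter.1 hi).2⟩
  have h1 := sum_le_sum fun i (_ : i ∈ (univ : Finset (Fin m))) ↦ hTcard i
  rw [sum_add_distrib] at h1
  simp only [sum_const, card_univ, Fintype.card_fin, smul_eq_mul] at h1
  have h2 : ∑ v ∈ V, endDegree a b F v + 2 * m * (V.image κ).card ≤ 2 * m * V.card := by
    rw [← sum_fiberwise_of_maps_to (fun v hv ↦ mem_image_of_mem κ hv),
      card_eq_sum_card_image κ V, mul_sum, mul_comm, ← smul_eq_mul, ← sum_const,
      ← sum_add_distrib]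
    refine sum_le_sum fun c hc ↦ ?_
    exact sum_endDegree_component_le (fun x hx ↦ hMV x (hFM' hx)) (fun x hx ↦ hκ x hx)
      (fun x hx ↦ hloop x (hFM' hx)) (fun v hv ↦ (endDegree.mono hFM' v).trans (hdeg v hv)) hc rfl
  rw [endDegree.sum_eq_two_mul fun x hx ↦ hMV x (hFM' hx)] at h2
  lia

open Classical in
/-- The edges of `B` with exactly one end in `A`. -/
noncomputable def edgeCut (a b : β → α) (B : Finset β) (A : Finset α) : Finset β :=
  B.filter fun e ↦ (a e ∈ A ∧ b e ∉ A) ∨ (a e ∉ A ∧ b e ∈ A)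

theorem mem_edgeCut {B : Finset β} {A : Finset α} {e : β} : e ∈ edgeCut a b B A ↔
    e ∈ B ∧ ((a e ∈ A ∧ b e ∉ A) ∨ (a e ∉ A ∧ b e ∈ A)) := by
  classical
  exact mem_filter

theorem card_edgeCut_le_sum {B : Finset β} {A U : Finset α}
    (h : ∀ e ∈ edgeCut a b B A, a e ∈ U ∨ b e ∈ U) :
    (edgeCut a b B A).card ≤ ∑ v ∈ U, endDegree a b B v := by
  classical
  rw [endDegree.sum_eq]
  refine le_trans (card_le_card fun e he ↦ ?_) (card_union_le _ _)
  have heB : e ∈ B := (mem_edgeCut.1 he).1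
  simpa [heB] using h e he

theorem card_edgeCut_le_add [DecidableEq β] {E F : Finset β} {A : Finset α} :
    (edgeCut a b E A).card ≤ (edgeCut a b (E \ F) A).card + (edgeCut a b F A).card := by
  classical
  refine le_trans (card_le_card fun e he ↦ ?_) (card_union_le _ _)
  simp only [mem_edgeCut, mem_union, mem_sdiff] at he ⊢
  tauto

/-- Let `F` be a set of edges that meets the vertex set `X` only in edges of `M`, where `M` is
loopless with maximum degree at most `m`, and let `t` be the number of components of `F`. Within each
component `C`, the edges of `F` at `C ∩ X` number at most `m |C ∩ X|`, with room to spare if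
`C ⊆ X`; otherwise the cut of `C \ X` has at least `2m` edges. -/
theorem sum_endDegree_add_le {m : ℕ} [DecidableEq α] [DecidableEq β] {V X : Finset α}
    {E F M : Finset β} {κ : α → α}
    (hEV : ∀ e ∈ E, a e ∈ V ∧ b e ∈ V) (hFE : F ⊆ E) (hκ : ∀ e ∈ F, κ (a e) = κ (b e))
    (hXV : X ⊆ V) (hX : ∀ e ∈ F, e ∉ M → a e ∉ X ∧ b e ∉ X)
    (hloop : ∀ e ∈ M, a e ≠ b e) (hdeg : ∀ v ∈ V, endDegree a b M v ≤ m)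
    (hcut : ∀ A ⊆ V, A.Nonempty → A ≠ V → 2 * m ≤ (edgeCut a b E A).card)
    (hproper : ∀ c ∈ V.image κ, (V.filter (κ · = c)) \ X ≠ V) :
    ∑ v ∈ X, endDegree a b E v + 2 * m * (V.image κ).card ≤
      2 * (E \ F).card + 2 * m * X.card := by
  have hFX : ∀ v ∈ X, endDegree a b F v ≤ m := fun v hv ↦ by
    refine le_trans ?_ (hdeg v (hXV hv))
    rw [← endDegree.sdiff_add (inter_subset_left : F ∩ M ⊆ F),
      endDegree.eq_zero (A := F \ (F ∩ M)), zero_add]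
    · exact endDegree.mono inter_subset_right v
    · intro e he
      simp only [mem_sdiff, mem_inter, not_and] at he
      obtain ⟨h1, h2⟩ := hX e he.1 (he.2 he.1)
      exact ⟨by rintro rfl; exact h1 hv, by rintro rfl; exact h2 hv⟩
  have hsub : ∀ v, endDegree a b E v = endDegree a b (E \ F) v + endDegree a b F v :=
    fun v ↦ (endDegree.sdiff_add hFE v).symm
  have key : ∀ c ∈ V.image κ,
      ∑ v ∈ X.filter (κ · = c), endDegree a b E v + 2 * m ≤
        ∑ v ∈ V.filter (κ · = c), endDegree a b (E \ F) v +
          2 * m * (X.filter (κ · = c)).card := by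
    intro c hc
    set C := V.filter (κ · = c) with hC
    set Y := X.filter (κ · = c) with hY
    have hYC : Y ⊆ C := filter_subset_filter _ hXV
    rw [sum_congr rfl fun v _ ↦ hsub v, sum_add_distrib]
    by_cases hCY : C ⊆ Y
    · have hYC' : Y = C := hYC.antisymm hCY
      have hCX : C ⊆ X := hCY.trans (filter_subset _ _)
      -- an edge of `F` with an end in `C` has both ends in `C`, so it belongs to `M`
      have hFC : ∀ v ∈ C, endDegree a b F v = endDegree a b (F.filter (· ∈ M)) v := fun v hv ↦ by
        rw [← endDegree.sdiff_add (filter_subset (· ∈ M) F), endDegree.eq_zero, zero_add]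
        intro e he
        simp only [mem_sdiff, mem_filter, not_and] at he
        obtain ⟨h1, h2⟩ := hX e he.1 (he.2 he.1)
        exact ⟨by rintro rfl; exact h1 (hCX hv), by rintro rfl; exact h2 (hCX hv)⟩
      have := sum_endDegree_component_le (a := a) (b := b) (V := V) (F := F.filter (· ∈ M))
        (fun e he ↦ hEV e (hFE (mem_filter.1 he).1)) (fun e he ↦ hκ e (mem_filter.1 he).1)
        (fun e he ↦ hloop e (mem_filter.1 he).2)
        (fun v hv ↦ (endDegree.mono (fun e he ↦ (mem_filter.1 he).2) v).trans (hdeg v hv)) hc hC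
      rw [hYC', sum_congr rfl hFC]
      lia
    · obtain ⟨w, hwC, hwY⟩ := not_subset.1 hCY
      have hCX : C \ X = C \ Y := by
        ext v
        simp only [mem_sdiff, hY, mem_filter]
        refine and_congr_right fun hv ↦ ?_
        simp [(mem_filter.1 (hC ▸ hv)).2]
      have h1 := hcut (C \ X) (sdiff_subset.trans (filter_subset _ _))
        ⟨w, by rw [hCX]; exact mem_sdiff.2 ⟨hwC, hwY⟩⟩ (hproper c hc)
      rw [hCX] at h1
      have h2 := card_edgeCut_le_add (a := a) (b := b) (E := E) (F := F) (A := C \ Y)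
      have h3 : (edgeCut a b (E \ F) (C \ Y)).card ≤ ∑ v ∈ C \ Y, endDegree a b (E \ F) v :=
        card_edgeCut_le_sum fun e he ↦ by
          have := (mem_edgeCut.1 he).2
          tauto
      have h4 : (edgeCut a b F (C \ Y)).card ≤ ∑ v ∈ Y, endDegree a b F v :=
        card_edgeCut_le_sum fun e he ↦ by
          obtain ⟨heF, h⟩ := mem_edgeCut.1 he
          have h5 := hκ e heF
          have h6 := hEV e (hFE heF)
          simp only [mem_sdiff, hC, mem_filter] at h
          grind
      have h5 := sum_le_card_nsmul Y _ m fun v hv ↦ hFX v ((mem_filter.1 hv).1)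
      have h6 := sum_sdiff (f := fun v ↦ endDegree a b (E \ F) v) hYC
      rw [smul_eq_mul] at h5
      nlinarith
  have hEF := endDegree.sum_eq_two_mul (a := a) (b := b) (A := E \ F) (V := V)
    fun e he ↦ hEV e (mem_sdiff.1 he).1
  rw [← hEF, ← sum_fiberwise_of_maps_to (s := V) (fun v hv ↦ mem_image_of_mem κ hv),
    ← sum_fiberwise_of_maps_to (s := X) (fun v hv ↦ mem_image_of_mem κ (hXV hv)),
    card_eq_sum_card_fiberwise (s := X) (fun v hv ↦ mem_image_of_mem κ (hXV hv)),
    mul_sum, mul_comm (2 * m), ← smul_eq_mul (#_), ← sum_const, ← sum_add_distrib,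
    ← sum_add_distrib]
  exact sum_le_sum key

end

section

open Submodule Finset

variable {α β : Type*} {a b : β → α}

/-! ### Packing spanning trees together with owned edges -/

/-- The edges outside `M₀` that `F` misses are numerous enough for all the trees and owned edges that
are not spanned by `F`. -/
theorem card_le_of_components {m : ℕ} [DecidableEq α] [DecidableEq β] {V X : Finset α}
    {E F M M₀ : Finset β} {κ : α → α} {r k : α → ℕ}
    (hEV : ∀ e ∈ E, a e ∈ V ∧ b e ∈ V) (hFE : F ⊆ E \ M₀) (hκ : ∀ e ∈ F, κ (a e) = κ (b e))
    (hXV : X ⊆ V) (hX : ∀ e ∈ F, e ∉ M → a e ∉ X ∧ b e ∉ X)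
    (hloop : ∀ e ∈ M, a e ≠ b e) (hdeg : ∀ v ∈ V, endDegree a b M v ≤ m)
    (hcut : ∀ A ⊆ V, A.Nonempty → A ≠ V → 2 * m ≤ (edgeCut a b E A).card)
    (hr : ∑ v ∈ V, r v + M₀.card ≤ m)
    (hk : ∀ X ⊆ V, 2 * ∑ v ∈ X, k v + 2 * m * X.card ≤
      ∑ v ∈ X, endDegree a b E v + 2 * ∑ v ∈ X, r v + 1) :
    m * (V.image κ).card + ∑ v ∈ X, k v ≤ ((E \ M₀) \ F).card + m := by
  by_cases hproper : ∀ c ∈ V.image κ, (V.filter (κ · = c)) \ X ≠ V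
  · have h1 := sum_endDegree_add_le hEV (hFE.trans sdiff_subset) hκ hXV hX hloop hdeg hcut hproper
    have h2 := hk X hXV
    have h3 : (E \ F).card ≤ ((E \ M₀) \ F).card + M₀.card := by
      refine le_trans (card_le_card fun e he ↦ ?_) (card_union_le _ _)
      simp only [mem_sdiff, mem_union] at he ⊢
      tauto
    have h4 : ∑ v ∈ X, r v ≤ ∑ v ∈ V, r v := sum_le_sum_of_subset hXV
    have h5 : 2 * m * (V.image κ).card = 2 * (m * (V.image κ).card) := mul_assoc _ _ _
    lia
  · push Not at hproper
    obtain ⟨c, -, hc⟩ := hproper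
    have hX0 : X = ∅ := eq_empty_of_forall_notMem fun v hv ↦ by
      have := hXV hv
      rw [← hc] at this
      exact (mem_sdiff.1 this).2 hv
    have ht : (V.image κ).card ≤ 1 := card_le_one.2 fun x hx y hy ↦ by
      have : ∀ x ∈ V.image κ, x = c := fun x hx ↦ by
        obtain ⟨v, hv, rfl⟩ := mem_image.1 hx
        rw [← hc] at hv
        exact (mem_filter.1 (mem_sdiff.1 hv).1).2
      rw [this x hx, this y hy]
    have := Nat.mul_le_mul_left m ht
    simp only [hX0, sum_empty]
    lia

open Classical in
/-- The vectors representing the rank-one matroid in which the non-loops are the edges at `v`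
outside `M`. -/
noncomputable def starVec (a b : β → α) (M : Finset β) (v : α) (e : β) : α →₀ ℚ :=
  if e ∉ M ∧ (a e = v ∨ b e = v) then Finsupp.single v 1 else 0

theorem card_le_one_of_linearIndepOn_starVec {M T : Finset β} {v : α}
    (h : LinearIndepOn ℚ (starVec a b M v) (T : Set β)) : T.card ≤ 1 := by
  classical
  refine (h.card_le_card_of_subset_span (U := {Finsupp.single v 1}) ?_).trans (by simp)
  rintro _ ⟨e, -, rfl⟩
  unfold starVec
  split_ifs
  · exact subset_span (by simp)
  · exact zero_mem _

theorem incident_of_linearIndepOn_starVec {M : Finset β} {S : Set β} {v : α}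
    (h : LinearIndepOn ℚ (starVec a b M v) S) {e : β} (he : e ∈ S) :
    e ∉ M ∧ (a e = v ∨ b e = v) := by
  by_contra hcon
  exact h.ne_zero he (if_neg hcon)

/-- The edges outside `M₀` contain `m` disjoint spanning trees that together cover `M`, and, disjoint
from these and from each other, sets of `k v` edges at each vertex `v`. -/
theorem exists_trees_and_stars {m : ℕ} {V : Finset α} (hV : m = 0 ∨ V.Nonempty)
    {E M M₀ : Finset β} {r k : α → ℕ}
    (hEV : ∀ e ∈ E, a e ∈ V ∧ b e ∈ V) (hME : M ⊆ E) (hMM₀ : Disjoint M M₀)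
    (hloop : ∀ e ∈ M, a e ≠ b e) (hdeg : ∀ v ∈ V, endDegree a b M v ≤ m)
    (hcut : ∀ A ⊆ V, A.Nonempty → A ≠ V → 2 * m ≤ (edgeCut a b E A).card)
    (hr : ∑ v ∈ V, r v + M₀.card ≤ m)
    (hk : ∀ X ⊆ V, 2 * ∑ v ∈ X, k v + 2 * m * X.card ≤
      ∑ v ∈ X, endDegree a b E v + 2 * ∑ v ∈ X, r v + 1) :
    ∃ (T : Fin m → Finset β) (Z : α → Finset β),
      (∀ i, T i ⊆ E ∧ Disjoint (T i) M₀ ∧ LinearIndepOn ℚ (edgeVec a b) (T i : Set β) ∧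
        V.card ≤ (T i).card + 1) ∧
      Pairwise (Function.onFun Disjoint T) ∧ (∀ e ∈ M, ∃ i, e ∈ T i) ∧
      (∀ v, Z v ⊆ E ∧ Disjoint (Z v) M₀ ∧ (∀ i, Disjoint (Z v) (T i)) ∧
        ∀ e ∈ Z v, a e = v ∨ b e = v) ∧
      Pairwise (Function.onFun Disjoint Z) ∧ ∀ v ∈ V, k v ≤ (Z v).card := by
  classical
  obtain ⟨S₀, hS₀M, hS₀, hMS₀⟩ := exists_forest_cover (fun e he ↦ hEV e (hME he)) hloop hdeg
  let ι := Fin m ⊕ (Σ v : V, Fin (k v))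
  let f : ι → β → α →₀ ℚ :=
    Sum.elim (fun _ ↦ edgeVec a b) fun p ↦ starVec a b M p.1
  have hM₁ : M ⊆ E \ M₀ := fun e he ↦ mem_sdiff.2 ⟨hME he, disjoint_left.1 hMM₀ he⟩
  obtain ⟨S, F, hSE, hS, hdis, hcov₀, hFE, hcov, hspan⟩ :=
    IndepCover.exists_disjoint_cover (K := ℚ) (f := f) (E \ M₀).finite_toSet
      (Sum.elim S₀ fun _ ↦ ∅)
      (by rintro (i | p)
          · exact (hS₀M i).trans (by exact_mod_cast hM₁)
          · exact Set.empty_subset _)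
      (by rintro (i | p)
          · exact hS₀ i
          · exact linearIndepOn_empty _ _)
  lift F to Finset β using (E \ M₀).finite_toSet.subset hFE
  have hFE' : F ⊆ E \ M₀ := by exact_mod_cast hFE
  have hFin : ∀ i, ∃ T : Finset β, (T : Set β) = S i := fun i ↦
    ⟨((E \ M₀).finite_toSet.subset (hSE i)).toFinset, by simp⟩
  choose s hs using hFin
  have hsE : ∀ i, s i ⊆ E \ M₀ := fun i ↦ by rw [← coe_subset, hs]; exact hSE i
  have hsind : ∀ i, LinearIndepOn ℚ (f i) (s i : Set β) := fun i ↦ by rw [hs]; exact hS i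
  have hsdis : Pairwise (Function.onFun Disjoint s) := fun i j hij ↦ by
    have := hdis hij
    simp only [Function.onFun, ← hs] at this ⊢
    exact_mod_cast this
  have hsspan : ∀ i, ∀ x ∈ F, f i x ∈ span ℚ (f i '' (s i ∩ F : Finset β)) := fun i x hx ↦ by
    rw [coe_inter, hs]; exact hspan i x hx
  obtain ⟨κ, hκ, hκspan⟩ := exists_component_representative a b (F : Set β)
  set X := V.filter fun v ↦ ∀ e ∈ F, e ∉ M → a e ≠ v ∧ b e ≠ v
  have hcount := card_le_of_components hEV hFE' (fun e he ↦ hκ e he) (filter_subset _ _ : X ⊆ V)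
    (fun e he heM ↦ ⟨fun h ↦ ((mem_filter.1 h).2 e he heM).1 rfl,
      fun h ↦ ((mem_filter.1 h).2 e he heM).2 rfl⟩) hloop hdeg hcut hr hk
  -- the ranks of the matroids, and lower bounds for the ranks of `F` in them
  let u : ι → ℕ := Sum.elim (fun _ ↦ V.card - 1) fun _ ↦ 1
  let l : ι → ℕ := Sum.elim (fun _ ↦ V.card - (V.image κ).card) fun p ↦ if p.1.1 ∈ X then 0 else 1
  have hu : ∀ i, (s i).card ≤ u i := by
    rintro (i | p)
    · have := card_forest_lt (hV.resolve_left (by rintro rfl; exact i.elim0))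
        (fun e he ↦ hEV e (mem_sdiff.1 (hsE _ he)).1) (hsind (Sum.inl i))
      exact Nat.le_sub_of_add_le this
    · exact card_le_one_of_linearIndepOn_starVec (hsind (Sum.inr p))
  have hl : ∀ i, l i ≤ (s i ∩ F).card := by
    rintro (i | p)
    · exact Nat.sub_le_of_le_add (card_le_card_add_card_image (fun v _ ↦ hκspan v)
        fun x hx ↦ hsspan (Sum.inl i) x hx)
    · by_cases hp : p.1.1 ∈ X
      · simp [l, hp]
      · have : ∃ e ∈ F, e ∉ M ∧ (a e = p.1.1 ∨ b e = p.1.1) := by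
          by_contra! h
          exact hp (mem_filter.2 ⟨p.1.2, h⟩)
        obtain ⟨e, heF, he⟩ := this
        simp only [l, Sum.elim_inr, hp, if_false]
        refine card_pos.2 ?_
        by_contra hne
        have := hsspan (Sum.inr p) e heF
        rw [not_nonempty_iff_eq_empty.1 hne] at this
        simp [f, starVec, he] at this
  have hsum : ((E \ M₀) \ F).card + ∑ i, l i ≤ ∑ i, (s i).card := by
    have h1 : (E \ M₀) \ F ⊆ (univ.biUnion s) \ F := fun e he ↦ by
      obtain ⟨h1, h2⟩ := mem_sdiff.1 he
      obtain ⟨i, hi⟩ := Set.mem_iUnion.1 (hcov (a := e) ⟨h1, h2⟩)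
      rw [← hs] at hi
      exact mem_sdiff.2 ⟨mem_biUnion.2 ⟨i, mem_univ _, hi⟩, h2⟩
    have h2 : ∑ i, l i ≤ (univ.biUnion s ∩ F).card := by
      rw [biUnion_inter, card_biUnion fun i _ j _ hij ↦
        (hsdis hij).mono inter_subset_left inter_subset_left]
      exact sum_le_sum fun i _ ↦ hl i
    rw [← card_biUnion fun i _ j _ hij ↦ hsdis hij, ← card_sdiff_add_card_inter (univ.biUnion s) F]
    exact add_le_add (card_le_card h1) h2
  have hul : ∑ i, u i ≤ ∑ i, (s i).card := by
    refine le_trans ?_ hsum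
    have hsumu : ∑ i, u i = m * (V.card - 1) + ∑ v ∈ V, k v := by
      rw [Fintype.sum_sum_type, Fintype.sum_sigma, ← sum_coe_sort V k]
      simp [u]
    have hsuml : ∑ i, l i = m * (V.card - (V.image κ).card) +
        ∑ v ∈ V, k v * if v ∈ X then 0 else 1 := by
      rw [Fintype.sum_sum_type, Fintype.sum_sigma,
        ← sum_coe_sort V fun v ↦ k v * if v ∈ X then 0 else 1]
      simp only [l, Sum.elim_inl, Sum.elim_inr, sum_const, card_univ, Fintype.card_fin, smul_eq_mul]
      congr 1
      exact sum_congr rfl fun x _ ↦ by by_cases hx : x.1 ∈ X <;> simp [hx]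
    rw [hsumu, hsuml]
    have h1 : ∑ v ∈ V, k v = ∑ v ∈ X, k v + ∑ v ∈ V, k v * if v ∈ X then 0 else 1 := by
      rw [← sum_filter_add_sum_filter_not V (· ∈ X)]
      congr 1
      · rw [filter_mem_eq_inter, inter_eq_right.2 (filter_subset _ _)]
      · rw [sum_filter]
        exact sum_congr rfl fun v _ ↦ by split_ifs <;> simp_all
    have h2 : (V.image κ).card ≤ V.card := card_image_le
    rcases hV with rfl | hV
    · lia
    · have := card_pos.2 hV
      obtain ⟨p, hp⟩ := Nat.exists_eq_add_of_le h2
      obtain ⟨q, hq⟩ := Nat.exists_eq_add_of_le this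
      have h3 : m * V.card = m * (V.image κ).card + m * p := by rw [hp]; ring
      have h4 : m * V.card = m + m * q := by rw [hq]; ring
      rw [show V.card - 1 = q by lia, show V.card - (V.image κ).card = p by lia]
      lia
  have heq : ∀ i, (s i).card = u i := fun i ↦
    (sum_eq_sum_iff_of_le fun i _ ↦ hu i).1 (le_antisymm (sum_le_sum fun i _ ↦ hu i) hul) i
      (mem_univ i)
  let Z : α → Finset β := fun v ↦
    if h : v ∈ V then univ.biUnion fun j : Fin (k v) ↦ s (Sum.inr ⟨⟨v, h⟩, j⟩) else ∅
  have hZ : ∀ v e, e ∈ Z v → ∃ (h : v ∈ V) (j : Fin (k v)), e ∈ s (Sum.inr ⟨⟨v, h⟩, j⟩) := by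
    intro v e he
    by_cases h : v ∈ V
    · simp only [Z, h, dif_pos, mem_biUnion, mem_univ, true_and] at he
      exact ⟨h, he⟩
    · simp [Z, h] at he
  refine ⟨fun i ↦ s (Sum.inl i), Z, fun i ↦ ⟨?_, ?_, hsind (Sum.inl i), ?_⟩, ?_, ?_, ?_, ?_, ?_⟩
  · exact (hsE _).trans sdiff_subset
  · exact disjoint_of_subset_left (hsE _) sdiff_disjoint
  · have := heq (Sum.inl i)
    simp only [u, Sum.elim_inl] at this
    lia
  · exact fun i j hij ↦ hsdis (Sum.inl_injective.ne hij)
  · intro e he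
    obtain ⟨i, hi⟩ := Set.mem_iUnion.1 (hMS₀ he)
    obtain ⟨j | p, hj⟩ := Set.mem_iUnion.1 (hcov₀ (Set.mem_iUnion.2 ⟨Sum.inl i, hi⟩))
    · rw [← hs] at hj
      exact ⟨j, hj⟩
    · exact absurd he (incident_of_linearIndepOn_starVec (hS (Sum.inr p)) hj).1
  · refine fun v ↦ ⟨fun e he ↦ ?_, disjoint_left.2 fun e he ↦ ?_,
      fun i ↦ disjoint_left.2 fun e he hei ↦ ?_, fun e he ↦ ?_⟩ <;> obtain ⟨h, j, hj⟩ := hZ v e he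
    · exact (mem_sdiff.1 (hsE _ hj)).1
    · exact (mem_sdiff.1 (hsE _ hj)).2
    · exact disjoint_left.1 (hsdis (by simp)) hei hj
    · exact (incident_of_linearIndepOn_starVec (hsind (Sum.inr ⟨⟨v, h⟩, j⟩)) hj).2
  · refine fun v w hvw ↦ disjoint_left.2 fun e he hew ↦ ?_
    obtain ⟨h, j, hj⟩ := hZ v e he
    obtain ⟨h', j', hj'⟩ := hZ w e hew
    refine disjoint_left.1 (hsdis fun heq ↦ hvw ?_) hj hj'
    exact congrArg (fun p ↦ p.1.1) (Sum.inr_injective heq)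
  · intro v hv
    simp only [Z, hv, dif_pos]
    have hdisv : Set.PairwiseDisjoint (univ : Finset (Fin (k v)))
        fun j ↦ s (Sum.inr ⟨⟨v, hv⟩, j⟩) := fun i _ j _ hij ↦
      hsdis (Sum.inr_injective.ne (sigma_mk_injective.ne hij))
    rw [card_biUnion hdisv]
    simp [heq, u]

end

section

open Submodule Finset

variable {α β : Type*} {a b : β → α}

/-! ### Factors with prescribed degrees -/

/-- A vertex property that is the same at both ends of each edge of `T` is constant on the
components of `T`. -/
theorem iff_of_sub_single_mem_span {T : Set β} {x y : α}
    (h : (Finsupp.single x 1 - Finsupp.single y 1 : α →₀ ℚ) ∈ span ℚ (edgeVec a b '' T))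
    {P : α → Prop} (hP : ∀ e ∈ T, P (a e) ↔ P (b e)) : P x ↔ P y := by
  classical
  let φ := Finsupp.linearCombination ℚ fun v ↦ if P v then (1 : ℚ) else 0
  have hle : span ℚ (edgeVec a b '' T) ≤ LinearMap.ker φ := by
    rw [span_le]
    rintro _ ⟨e, he, rfl⟩
    simp [φ, edgeVec, hP e he]
  have := hle h
  by_cases hx : P x <;> by_cases hy : P y <;> simp [φ, hx, hy] at this ⊢

theorem endDegree_pos_of_sub_single_mem_span {T : Finset β} {x y : α} (hxy : x ≠ y)
    (h : (Finsupp.single x 1 - Finsupp.single y 1 : α →₀ ℚ) ∈ span ℚ (edgeVec a b '' T)) :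
    0 < endDegree a b T x := by
  by_contra h0
  have hinc : ∀ e ∈ T, a e ≠ x ∧ b e ≠ x := by
    by_contra! hcon
    obtain ⟨e, he, hex⟩ := hcon
    have := endDegree.mono (a := a) (b := b) (singleton_subset_iff.2 he) x
    have := endDegree.singleton_pos (a := a) (b := b) (e := e) (v := x) (by tauto)
    lia
  have := iff_of_sub_single_mem_span h (P := (· = x)) fun e he ↦
    iff_of_false (hinc e he).1 (hinc e he).2
  exact hxy (this.1 rfl).symm

theorem endDegree_biUnion_ge {m : ℕ} [DecidableEq β] {T : Fin m → Finset β}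
    (hT : Pairwise (Function.onFun Disjoint T)) {v : α} (h : ∀ i, 0 < endDegree a b (T i) v) :
    m ≤ endDegree a b (univ.biUnion T) v := by
  classical
  have key : ∀ s : Finset (Fin m), s.card ≤ endDegree a b (s.biUnion T) v := by
    intro s
    induction s using Finset.induction_on with
    | empty => simp
    | insert i s hi ih =>
      have hdis : Disjoint (T i) (s.biUnion T) := by
        rw [disjoint_biUnion_right]
        exact fun j hj ↦ hT (by rintro rfl; exact hi hj)
      rw [biUnion_insert, endDegree.union hdis, card_insert_of_notMem hi]
      have := h i
      lia
  simpa using key univ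

/-- The trees are kept, and a subset of the remaining edges avoids the degrees that are forbidden by
the lists once the edges of the trees are counted. -/
theorem exists_factor {m : ℕ} {V : Finset α} (hV : m = 0 ∨ 1 < V.card)
    {E M M₀ : Finset β} {r k : α → ℕ} {L : α → Finset ℕ}
    (hEV : ∀ e ∈ E, a e ∈ V ∧ b e ∈ V) (hME : M ⊆ E) (hM₀E : M₀ ⊆ E) (hMM₀ : Disjoint M M₀)
    (hloop : ∀ e ∈ M, a e ≠ b e) (hdeg : ∀ v ∈ V, endDegree a b M v ≤ m)
    (hcut : ∀ A ⊆ V, A.Nonempty → A ≠ V → 2 * m ≤ (edgeCut a b E A).card)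
    (hr : ∑ v ∈ V, r v + M₀.card ≤ m)
    (hk : ∀ X ⊆ V, 2 * ∑ v ∈ X, k v + 2 * m * X.card ≤
      ∑ v ∈ X, endDegree a b E v + 2 * ∑ v ∈ X, r v + 1)
    (hL : ∀ v ∈ V, L v ⊆ Icc m (endDegree a b E v - endDegree a b M₀ v))
    (hLk : ∀ v ∈ V, endDegree a b E v + 1 ≤ (L v).card + k v + m + endDegree a b M₀ v) :
    ∃ (T : Fin m → Finset β) (H : Finset β),
      (∀ i, T i ⊆ H ∧ LinearIndepOn ℚ (edgeVec a b) (T i : Set β) ∧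
        ∀ x ∈ V, ∀ y ∈ V, (Finsupp.single x 1 - Finsupp.single y 1 : α →₀ ℚ) ∈
          span ℚ (edgeVec a b '' T i)) ∧
      Pairwise (Function.onFun Disjoint T) ∧ M ⊆ H ∧ H ⊆ E ∧ Disjoint H M₀ ∧
      ∀ v ∈ V, endDegree a b H v ∈ L v := by
  classical
  obtain ⟨T, Z, hT, hTdis, hMT, hZ, hZdis, hkZ⟩ := exists_trees_and_stars
    (hV.imp_right fun h ↦ card_pos.1 (by lia)) hEV hME hMM₀ hloop hdeg hcut hr hk
  have hTspan : ∀ i, ∀ x ∈ V, ∀ y ∈ V, (Finsupp.single x 1 - Finsupp.single y 1 : α →₀ ℚ) ∈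
      span ℚ (edgeVec a b '' T i) := fun i x hx y hy ↦
    sub_single_mem_span_of_card (fun e he ↦ hEV e ((hT i).1 he)) (hT i).2.2.1 (hT i).2.2.2 hx hy
  set U := univ.biUnion T
  have hUE : U ⊆ E \ M₀ := biUnion_subset.2 fun i _ ↦ subset_sdiff.2 ⟨(hT i).1, (hT i).2.1⟩
  set W := (E \ M₀) \ U
  have hdegU : ∀ v ∈ V, m ≤ endDegree a b U v := fun v hv ↦ by
    rcases hV with rfl | hV
    · exact Nat.zero_le _
    · obtain ⟨y, hy, hyv⟩ := exists_mem_ne hV v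
      exact endDegree_biUnion_ge hTdis fun i ↦
        endDegree_pos_of_sub_single_mem_span hyv.symm (hTspan i v hv y hy)
  let F : α → Finset ℕ := fun v ↦ if v ∈ V then
    (range (endDegree a b W v + 1)).filter (endDegree a b U v + · ∉ L v) else ∅
  have hF : ∀ v, (F v).card ≤ (Z v).card := fun v ↦ by
    by_cases hv : v ∈ V
    · simp only [F, hv, if_true]
      have h1 := endDegree.sdiff_add (a := a) (b := b) hM₀E v
      have h2 := endDegree.sdiff_add (a := a) (b := b) hUE v
      have h3 := card_filter_add_card_filter_not (s := range (endDegree a b W v + 1))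
        (endDegree a b U v + · ∈ L v)
      rw [card_range] at h3
      -- only the values in `[m, d_U(v))` of the list are lost
      have h4 : L v ⊆ Ico m (endDegree a b U v) ∪
          ((range (endDegree a b W v + 1)).filter (endDegree a b U v + · ∈ L v)).image
            (endDegree a b U v + ·) := fun x hx ↦ by
        have hx' := mem_Icc.1 (hL v hv hx)
        by_cases hxU : x < endDegree a b U v
        · exact mem_union_left _ (mem_Ico.2 ⟨hx'.1, hxU⟩)
        · refine mem_union_right _ (mem_image.2 ⟨x - endDegree a b U v, ?_, by lia⟩)
          rw [mem_filter, mem_range, Nat.add_sub_cancel' (by lia)]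
          exact ⟨by lia, hx⟩
      have h5 := (card_le_card h4).trans
        ((card_union_le _ _).trans (Nat.add_le_add_left card_image_le _))
      rw [Nat.card_Ico] at h5
      have h6 := hdegU v hv
      have h7 := hLk v hv
      have h8 := hkZ v hv
      lia
    · simp [F, hv]
  obtain ⟨H, hHW, hH⟩ := exists_subset_endDegree_notMem a b W Z
    (fun v e he ↦ mem_sdiff.2 ⟨mem_sdiff.2 ⟨(hZ v).1 he, disjoint_left.1 (hZ v).2.1 he⟩, fun h ↦ by
      obtain ⟨i, -, hi⟩ := mem_biUnion.1 h
      exact disjoint_left.1 ((hZ v).2.2.1 i) he hi⟩)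
    hZdis (fun v ↦ (hZ v).2.2.2) F hF
  have hUH : Disjoint U H := disjoint_of_subset_right hHW disjoint_sdiff
  have hUHE : U ∪ H ⊆ E \ M₀ := union_subset hUE (hHW.trans sdiff_subset)
  refine ⟨T, U ∪ H, fun i ↦ ⟨?_, (hT i).2.2.1, hTspan i⟩, hTdis, fun e he ↦ ?_,
    hUHE.trans sdiff_subset, disjoint_of_subset_left hUHE sdiff_disjoint, fun v hv ↦ ?_⟩
  · exact (subset_biUnion_of_mem T (mem_univ i)).trans subset_union_left
  · obtain ⟨i, hi⟩ := hMT e he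
    exact mem_union_left _ (mem_biUnion.2 ⟨i, mem_univ _, hi⟩)
  · by_contra hcon
    rw [endDegree.union hUH] at hcon
    refine hH v ?_
    simp only [F, hv, if_true, mem_filter, mem_range]
    exact ⟨Nat.lt_succ_of_le (endDegree.mono hHW v), hcon⟩

end

namespace Graph

variable {α β : Type*} {G : Graph α β} {a b : β → α}

/-! ### Translation to graphs -/

theorem degree_eq_endDegree {H : Graph α β} {A : Finset β} (hA : H.edgeSet = A)
    (hab : ∀ e ∈ A, H.IsLink e (a e) (b e)) (v : α) : H.degree v = endDegree a b A v := by
  classical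
  have hmem : ∀ {e x y}, H.IsLink e x y → e ∈ A := fun h ↦ by
    have := h.edge_mem
    rwa [hA] at this
  have h1 : {e | H.IsLoopAt e v} = (A.filter fun e ↦ a e = v ∧ b e = v : Finset β) := by
    ext e
    simp only [Set.mem_ofPred_eq, Finset.coe_filter]
    refine ⟨fun h ↦ ⟨hmem h, ?_⟩, fun ⟨he, h⟩ ↦ ?_⟩
    · have := (hab e (hmem h)).isLink_iff.1 h
      tauto
    · exact (hab e he).isLink_iff.2 (Or.inl h)
  have h2 : {e | H.IsNonloopAt e v} =
      (A.filter fun e ↦ (a e = v ∧ b e ≠ v) ∨ (b e = v ∧ a e ≠ v) : Finset β) := by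
    ext e
    simp only [Set.mem_ofPred_eq, Finset.coe_filter]
    constructor
    · rintro ⟨y, hy, h⟩
      refine ⟨hmem h, ?_⟩
      obtain ⟨rfl, rfl⟩ | ⟨rfl, rfl⟩ := (hab e (hmem h)).isLink_iff.1 h
      · exact Or.inl ⟨rfl, hy⟩
      · exact Or.inr ⟨rfl, hy⟩
    · rintro ⟨he, ⟨rfl, h⟩ | ⟨rfl, h⟩⟩
      · exact ⟨_, h, hab e he⟩
      · exact ⟨_, h, (hab e he).symm⟩
  rw [degree, h1, h2, Set.ncard_coe_finset, Set.ncard_coe_finset, endDegree, Finset.filter_or,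
    Finset.card_union_of_disjoint (Finset.disjoint_filter.2 fun e _ h h' ↦ h.2 h'.1),
    ← Finset.card_filter_add_card_filter_not (s := A.filter fun e ↦ a e = v) fun e ↦ b e = v,
    ← Finset.card_filter_add_card_filter_not (s := A.filter fun e ↦ b e = v) fun e ↦ a e = v]
  simp only [Finset.filter_filter]
  have h3 : (A.filter fun e ↦ b e = v ∧ a e = v) = A.filter fun e ↦ a e = v ∧ b e = v :=
    Finset.filter_congr fun e _ ↦ and_comm
  rw [h3]
  ring

theorem cut_eq_edgeCut {E : Finset β} (hE : G.edgeSet = E)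
    (hab : ∀ e ∈ E, G.IsLink e (a e) (b e)) (A : Finset α) :
    G.cut A = (edgeCut a b E A : Set β) := by
  ext e
  simp only [cut, Set.mem_ofPred_eq, Finset.mem_coe, mem_edgeCut]
  constructor
  · rintro ⟨x, y, h, hx, hy⟩
    have he : e ∈ E := by
      have := h.edge_mem
      rwa [hE] at this
    refine ⟨he, ?_⟩
    obtain ⟨rfl, rfl⟩ | ⟨rfl, rfl⟩ := (hab e he).isLink_iff.1 h
    · exact Or.inl ⟨hx, hy⟩
    · exact Or.inr ⟨hy, hx⟩
  · rintro ⟨he, ⟨h, h'⟩ | ⟨h, h'⟩⟩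
    · exact ⟨_, _, hab e he, h, h'⟩
    · exact ⟨_, _, (hab e he).symm, h', h⟩

theorem outDegree_le_degree {H : Graph α β} (hH : H.Loopless) (hE : H.edgeSet.Finite)
    (D : H.Orientation) (v : α) : D.outDegree v ≤ H.degree v := by
  refine le_trans ?_ (Nat.le_add_right _ _)
  rw [Orientation.outDegree, ← Set.ncard_image_of_injective _ Subtype.val_injective]
  refine Set.ncard_le_ncard ?_ (hE.subset fun e he ↦ IsNonloopAt.edge_mem he)
  rintro _ ⟨e, rfl, rfl⟩
  exact ⟨_, (D.isLink e).ne.symm, D.isLink e⟩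

/-- A linearly independent set of edge vectors that spans all differences of vertices is the edge set
of a spanning tree. -/
theorem restrict_isTree {T : Finset β} (hTG : (T : Set β) ⊆ G.edgeSet)
    (hab : ∀ e ∈ G.edgeSet, G.IsLink e (a e) (b e)) (hV : G.vertexSet.Nonempty)
    (hT : LinearIndepOn ℚ (edgeVec a b) (T : Set β))
    (hspan : ∀ x ∈ G.vertexSet, ∀ y ∈ G.vertexSet,
      (Finsupp.single x 1 - Finsupp.single y 1 : α →₀ ℚ) ∈
        Submodule.span ℚ (edgeVec a b '' T)) :
    (G.restrict T).IsTree := by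
  refine ⟨⟨hV, fun x hx y hy ↦ ?_⟩, fun e x y hxy hreach ↦ ?_⟩
  · -- the set of vertices reachable from `x` is closed under the edges of `T`
    have hadj : ∀ e ∈ T, (G.restrict T).Adj (a e) (b e) := fun e he ↦ ⟨e, he, hab e (hTG he)⟩
    refine (iff_of_sub_single_mem_span (hspan x hx y hy) (P := (G.restrict T).Reachable x)
      fun e he ↦ ⟨fun h ↦ h.tail (hadj e he), fun h ↦ h.tail (hadj e he).symm⟩).1 .refl
  · obtain ⟨heT, hxy⟩ := hxy
    -- a walk avoiding `e` writes the vector of `e` as a combination of other edge vectors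
    have hedge : ∀ f u w, G.IsLink f u w → f ∈ T → f ≠ e →
        (Finsupp.single u 1 - Finsupp.single w 1 : α →₀ ℚ) ∈
          Submodule.span ℚ (edgeVec a b '' (T \ {e})) := fun f u w h hf hfe ↦ by
      have hmem : edgeVec a b f ∈ Submodule.span ℚ (edgeVec a b '' (T \ {e})) :=
        Submodule.subset_span ⟨f, ⟨hf, hfe⟩, rfl⟩
      obtain ⟨rfl, rfl⟩ | ⟨rfl, rfl⟩ := (hab f (hTG hf)).isLink_iff.1 h
      · exact hmem
      · simpa [edgeVec] using neg_mem hmem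
    have hwalk : ∀ w, ((G.restrict T).deleteEdges {e}).Reachable x w →
        (Finsupp.single x 1 - Finsupp.single w 1 : α →₀ ℚ) ∈
          Submodule.span ℚ (edgeVec a b '' (T \ {e})) := fun w h ↦ by
      induction h with
      | refl => simp
      | tail _ h ih =>
        obtain ⟨f, h⟩ := h
        rw [deleteEdges_isLink, restrict_isLink] at h
        simpa using add_mem ih (hedge f _ _ h.1.2 h.1.1 h.2)
    have hspan_e : edgeVec a b e ∈ Submodule.span ℚ (edgeVec a b '' (T \ {e})) := by
      have := hwalk y hreach
      obtain ⟨rfl, rfl⟩ | ⟨rfl, rfl⟩ := (hab e (hTG heT)).isLink_iff.1 hxy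
      · exact this
      · simpa [edgeVec] using neg_mem this
    have hins : LinearIndepOn ℚ (edgeVec a b) (insert e (T \ {e} : Set β)) := by
      rwa [Set.insert_sdiff_singleton, Set.insert_eq_of_mem (by exact_mod_cast heT)]
    exact hins.notMem_span_of_insert (by simp) hspan_e

end Graph

namespace Graph

variable {α β : Type*}

/-- A graph with at least one vertex, where the bound on the size of the list is relaxed at the vertex
`z`. -/
theorem exists_isTreeConnected_isListFactor (G M M₀ : Graph α β) (m : ℕ)
    (hV : G.vertexSet.Finite) (hE : G.edgeSet.Finite)
    (hV2 : m = 0 ∨ G.vertexSet.Nontrivial)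
    (hG : G.IsEdgeConnected (2 * m))
    (hM : M ≤s G) (hM₀ : M₀ ≤s G)
    (hMl : M.Loopless) (hM₀l : M₀.Loopless)
    (hdisj : Disjoint M.edgeSet M₀.edgeSet)
    (hMdeg : ∀ v ∈ G.vertexSet, M.degree v ≤ m)
    (hM₀card : M₀.edgeSet.ncard ≤ m)
    (D : M₀.Orientation)
    (L : α → Finset ℕ)
    (hL : ∀ v ∈ G.vertexSet, L v ⊆ Finset.Icc m (G.degree v - M₀.degree v))
    (r : α → ℕ)
    (hr : ∑ v ∈ hV.toFinset, r v = m - M₀.edgeSet.ncard)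
    (z : α) (hz : z ∈ G.vertexSet)
    (hLcard : ∀ v ∈ G.vertexSet, v ≠ z →
      ⌈(G.degree v : ℚ) / 2⌉ + 1 - (r v : ℤ) - (D.outDegree v : ℤ) ≤ ((L v).card : ℤ))
    (hLz : ⌊(G.degree z : ℚ) / 2⌋ + 1 - (r z : ℤ) - (D.outDegree z : ℤ) ≤ ((L z).card : ℤ)) :
    ∃ H : Graph α β, H.IsTreeConnected m ∧ H.IsListFactor G L ∧
      M.edgeSet ⊆ H.edgeSet ∧ Disjoint H.edgeSet M₀.edgeSet := by
  classical
  have : Nonempty α := ⟨z⟩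
  have hends : ∀ e, ∃ p : α × α, e ∈ G.edgeSet → G.IsLink e p.1 p.2 := fun e ↦ by
    by_cases he : e ∈ G.edgeSet
    · obtain ⟨x, y, h⟩ := G.exists_isLink_of_mem_edgeSet he
      exact ⟨(x, y), fun _ ↦ h⟩
    · exact ⟨(z, z), fun h ↦ absurd h he⟩
  choose p hp using hends
  set a : β → α := fun e ↦ (p e).1
  set b : β → α := fun e ↦ (p e).2
  have hab : ∀ e ∈ G.edgeSet, G.IsLink e (a e) (b e) := hp
  obtain ⟨V, hVV⟩ : ∃ V : Finset α, V = hV.toFinset := ⟨_, rfl⟩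
  have hmemV : ∀ v, v ∈ V ↔ v ∈ G.vertexSet := fun v ↦ by simp [hVV]
  have hVs : (V : Set α) = G.vertexSet := by ext v; simp [hmemV]
  obtain ⟨E, hEs⟩ : ∃ E : Finset β, G.edgeSet = E := ⟨hE.toFinset, by simp⟩
  obtain ⟨M', hM's⟩ : ∃ M' : Finset β, M.edgeSet = M' :=
    ⟨(hE.subset hM.le.edgeSet_mono).toFinset, by simp⟩
  obtain ⟨M₀', hM₀'s⟩ : ∃ M₀' : Finset β, M₀.edgeSet = M₀' :=
    ⟨(hE.subset hM₀.le.edgeSet_mono).toFinset, by simp⟩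
  have hM'E : M' ⊆ E := by
    have := hM.le.edgeSet_mono
    rw [hEs, hM's] at this
    exact_mod_cast this
  have hM₀'E : M₀' ⊆ E := by
    have := hM₀.le.edgeSet_mono
    rw [hEs, hM₀'s] at this
    exact_mod_cast this
  have habE : ∀ e ∈ E, G.IsLink e (a e) (b e) := fun e he ↦ hab e (by rw [hEs]; exact he)
  have habM : ∀ e ∈ M', M.IsLink e (a e) (b e) := fun e he ↦
    (hM.le.isLink_iff (by rw [hM's]; exact he)).2 (habE e (hM'E he))
  have habM₀ : ∀ e ∈ M₀', M₀.IsLink e (a e) (b e) := fun e he ↦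
    (hM₀.le.isLink_iff (by rw [hM₀'s]; exact he)).2 (habE e (hM₀'E he))
  have hdG := degree_eq_endDegree hEs habE
  have hdM := degree_eq_endDegree hM's habM
  have hdM₀ := degree_eq_endDegree hM₀'s habM₀
  have hout : ∀ v, D.outDegree v ≤ endDegree a b M₀' v := fun v ↦
    (outDegree_le_degree hM₀l (by rw [hM₀'s]; exact M₀'.finite_toSet) D v).trans (hdM₀ v).le
  have hcut : ∀ A ⊆ V, A.Nonempty → A ≠ V → 2 * m ≤ (edgeCut a b E A).card := by
    intro A hA hne hAV
    have := hG A (by exact_mod_cast hne) (by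
      rw [← hVs]; exact_mod_cast hA.ssubset_of_ne hAV)
    rwa [cut_eq_edgeCut hEs habE, Set.ncard_coe_finset] at this
  have hV2' : m = 0 ∨ 1 < V.card := hV2.imp_right fun h ↦ by
    rw [Finset.one_lt_card_iff_nontrivial, Finset.Nontrivial, hVs]
    exact h
  have hdeg2 : ∀ v ∈ V, 2 * m ≤ endDegree a b E v := fun v hv ↦ by
    rcases hV2' with rfl | h
    · simp
    · have h1 := hcut {v} (by simpa using hv) (by simp) (by rintro rfl; simp at h)
      refine h1.trans ?_
      rw [← Finset.sum_singleton (endDegree a b E) v]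
      refine card_edgeCut_le_sum fun e he ↦ ?_
      have := (mem_edgeCut.1 he).2
      tauto
  -- the number of edges to be owned by `v`: half of the degree, up to the shift by `r v - m`
  let k : α → ℕ := fun v ↦ (endDegree a b E v + if v = z then 1 else 0) / 2 + r v - m
  have hkm : ∀ v ∈ V, k v + m = (endDegree a b E v + if v = z then 1 else 0) / 2 + r v :=
    fun v hv ↦ by
      have := hdeg2 v hv
      simp only [k]
      split_ifs <;> lia
  have hk : ∀ X ⊆ V, 2 * ∑ v ∈ X, k v + 2 * m * X.card ≤
      ∑ v ∈ X, endDegree a b E v + 2 * ∑ v ∈ X, r v + 1 := fun X hX ↦ by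
    have h1 : ∀ v ∈ X, 2 * k v + 2 * m ≤
        endDegree a b E v + 2 * r v + if v = z then 1 else 0 := fun v hv ↦ by
      have := hkm v (hX hv)
      lia
    have h2 := Finset.sum_le_sum h1
    simp only [Finset.sum_add_distrib, ← Finset.mul_sum, Finset.sum_const, smul_eq_mul] at h2
    have h3 : (∑ v ∈ X, if v = z then 1 else 0) ≤ 1 := by
      rw [Finset.sum_ite_eq']
      split_ifs <;> simp
    lia
  have hLk : ∀ v ∈ V, endDegree a b E v + 1 ≤
      (L v).card + k v + m + endDegree a b M₀' v := fun v hv ↦ by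
    have h1 := hkm v hv
    have h2 := hout v
    by_cases hvz : v = z
    · subst hvz
      rw [hdG] at hLz
      have h3 : ⌊(endDegree a b E v : ℚ) / 2⌋ = ((endDegree a b E v / 2 : ℕ) : ℤ) := by
        have := Rat.floor_intCast_div_natCast (endDegree a b E v : ℤ) 2
        push_cast at this ⊢
        exact this
      rw [h3] at hLz
      simp only [if_true] at h1
      lia
    · have h3 := hLcard v ((hmemV v).1 hv) hvz
      rw [hdG] at h3
      have h4 : ((endDegree a b E v : ℚ) / 2) ≤ ⌈(endDegree a b E v : ℚ) / 2⌉ := Int.le_ceil _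
      have h5 : (endDegree a b E v : ℤ) ≤ 2 * ⌈(endDegree a b E v : ℚ) / 2⌉ := by
        have : (endDegree a b E v : ℚ) ≤ 2 * ⌈(endDegree a b E v : ℚ) / 2⌉ := by linarith
        exact_mod_cast this
      simp only [hvz, if_false] at h1
      lia
  obtain ⟨T, H, hT, hTdis, hMH, hHE, hHM₀, hHL⟩ := exists_factor hV2'
    (fun e he ↦ ⟨(hmemV _).2 (habE e he).left_mem, (hmemV _).2 (habE e he).right_mem⟩)
    hM'E hM₀'E (by rw [hM's, hM₀'s] at hdisj; exact_mod_cast hdisj)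
    (fun e he ↦ (habM e he).ne) (fun v hv ↦ by rw [← hdM]; exact hMdeg v ((hmemV v).1 hv))
    hcut (by rw [hM₀'s, Set.ncard_coe_finset] at hr hM₀card; rw [hVV, hr]; lia) hk
    (fun v hv ↦ by rw [← hdG, ← hdM₀]; exact hL v ((hmemV v).1 hv)) hLk
  have hTE : ∀ i, ((T i : Finset β) : Set β) ⊆ G.edgeSet := fun i ↦ by
    rw [hEs]; exact_mod_cast (hT i).1.trans hHE
  have hHs : (G.restrict H).edgeSet = H := by
    rw [edgeSet_restrict, hEs]
    exact Set.inter_eq_right.2 (by exact_mod_cast hHE)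
  refine ⟨G.restrict H, ⟨fun i ↦ G.restrict (T i), fun i ↦ ⟨⟨?_, rfl⟩, ?_⟩, fun i j hij ↦ ?_⟩,
    ⟨⟨restrict_le, rfl⟩, fun v hv ↦ ?_⟩, ?_, ?_⟩
  · exact restrict_mono_right _ (by exact_mod_cast (hT i).1)
  · exact restrict_isTree (hTE i) hab ⟨z, hz⟩ (hT i).2.1 fun x hx y hy ↦
      (hT i).2.2 x ((hmemV x).2 hx) y ((hmemV y).2 hy)
  · exact (Finset.disjoint_coe.2 (hTdis hij)).mono Set.inter_subset_right Set.inter_subset_right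
  · rw [degree_eq_endDegree hHs fun e he ↦ ⟨he, habE e (hHE he)⟩]
    exact hHL v ((hmemV v).2 hv)
  · rw [hHs, hM's]
    exact_mod_cast hMH
  · rw [hHs, hM₀'s]
    exact_mod_cast hHM₀

end Graph
theorem mainTheorem10 {α β : Type*} (G M M₀ : Graph α β) (m : ℕ)
    (hV : G.vertexSet.Finite) (hE : G.edgeSet.Finite)
    (hV2 : m = 0 ∨ G.vertexSet.Nontrivial)
    (hG : G.IsEdgeConnected (2 * m))
    (hM : M ≤s G) (hM₀ : M₀ ≤s G)
    (hMl : M.Loopless) (hM₀l : M₀.Loopless)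
    (hdisj : Disjoint M.edgeSet M₀.edgeSet)
    (hMdeg : ∀ v ∈ G.vertexSet, M.degree v ≤ m)
    (hM₀card : M₀.edgeSet.ncard ≤ m)
    (D : M₀.Orientation)
    (L : α → Finset ℕ)
    (hL : ∀ v ∈ G.vertexSet, L v ⊆ Finset.Icc m (G.degree v - M₀.degree v))
    (r : α → ℕ)
    (hr : ∑ v ∈ hV.toFinset, r v = m - M₀.edgeSet.ncard) :
    ((∀ v ∈ G.vertexSet,
        ⌈(G.degree v : ℚ) / 2⌉ + 1 - (r v : ℤ) - (D.outDegree v : ℤ) ≤ ((L v).card : ℤ)) →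
      ∃ H : Graph α β, H.IsTreeConnected m ∧ H.IsListFactor G L ∧
        M.edgeSet ⊆ H.edgeSet ∧ Disjoint H.edgeSet M₀.edgeSet) ∧
    (∀ z ∈ G.vertexSet,
      (∀ v ∈ G.vertexSet, v ≠ z →
        ⌈(G.degree v : ℚ) / 2⌉ + 1 - (r v : ℤ) - (D.outDegree v : ℤ) ≤ ((L v).card : ℤ)) →
      ⌊(G.degree z : ℚ) / 2⌋ + 1 - (r z : ℤ) - (D.outDegree z : ℤ) ≤ ((L z).card : ℤ) →
      ∃ H : Graph α β, H.IsTreeConnected m ∧ H.IsListFactor G L ∧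
        M.edgeSet ⊆ H.edgeSet ∧ Disjoint H.edgeSet M₀.edgeSet) := by
  have hz := Graph.exists_isTreeConnected_isListFactor G M M₀ m hV hE hV2 hG hM hM₀ hMl hM₀l hdisj
    hMdeg hM₀card D L hL r hr
  refine ⟨fun hLcard ↦ ?_, hz⟩
  obtain hV0 | ⟨z, hzV⟩ := G.vertexSet.eq_empty_or_nonempty
  · -- the graph without vertices, where `m = 0` and `G` itself is the factor
    obtain rfl : m = 0 := hV2.resolve_right fun h ↦ by simpa [hV0] using h.nonempty
    have hE0 : M₀.edgeSet = ∅ := Set.eq_empty_of_forall_notMem fun e he ↦ by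
      obtain ⟨x, y, h⟩ := M₀.exists_isLink_of_mem_edgeSet he
      simpa [hV0] using hM₀.vertexSet_mono h.left_mem
    exact ⟨G, ⟨fun i ↦ i.elim0, fun i ↦ i.elim0, fun i ↦ i.elim0⟩,
      ⟨Graph.IsSpanningSubgraph.rfl, by simp [hV0]⟩, hM.le.edgeSet_mono, by simp [hE0]⟩
  · refine hz z hzV (fun v hv _ ↦ hLcard v hv) (le_trans ?_ (hLcard z hzV))
    have := Int.floor_le_ceil ((G.degree z : ℚ) / 2)
    lia
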